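/- **Lemma 3.9.** Let $0<\gamma<1$, let $a<b$ and $c<d$ be real numbers, and let $u\in C^6([a,b]\times[c,d])$. For integers $M_x,M_y\ge 1$ put $h_x=(b-a)/M_x$, $h_y=(d-c)/M_y$, $x_{k/2}=a+\tfrac k2 h_x$ $(0\le k\le 2M_x)$ and $y_{k/2}=c+\tfrac k2 h_y$ $(0\le k\le 2M_y)$. For $x\in[a,b]$ let $$\phi_l(x)=\begin{cases}\dfrac{(x-x_{l-1})\,(2x-x_l-x_{l-1})}{h_x^2}, & x\in[x_{l-1},x_l],\ l\ge 1,\\[1ex] \dfrac{(x_{l+1}-x)\,(x_{l+1}+x_l-2x)}{h_x^2}, & x\in[x_l,x_{l+1}],\ l\le M_x-1,\\[1ex] 0,&\text{otherwise,}\end{cases}\qquad 0\le l\le M_x,$$ $$\phi_{l-\frac12}(x)=\begin{cases}\dfrac{4(x-x_{l-1})(x_l-x)}{h_x^2}, & x\in[x_{l-1},x_l],\\[1ex] 0,&\text{otherwise,}\end{cases}\qquad 1\le l\le M_x,$$ let $\tilde\phi_{r/2}(y)$, $0\le r\le 2M_y$, be the analogous functions on $[c,d]$ for the mesh points $y_{r/2}$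 and step $h_y$, and let $$u_Q(x,y)=\sum_{l=0}^{2M_x}\sum_{r=0}^{2M_y}\phi_{l/2}(x)\,\tilde\phi_{r/2}(y)\,u(x_{l/2},y_{r/2})$$ be the piecewise biquadratic Lagrange interpolant of $u$. Then there is a constant $C$, depending only on $\gamma,a,b,c,d$ and $u$, such that for all $M_x,M_y\ge1$, all $1\le i\le 2M_x-1$ and all $1\le j\le 2M_y-1$, the function $(x,y)\mapsto \dfrac{u(x,y)-u_Q(x,y)}{|x_{i/2}-x|^\gamma|y_{j/2}-y|^\gamma}$ is integrable on $[a,b]\times[c,d]$ and $$\left|\int_c^d\!\int_a^b \frac{u(x,y)-u_Q(x,y)}{|x_{i/2}-x|^{\gamma}\,|y_{j/2}-y|^{\gamma}}\,dx\,dy\right|\le C\left(h_x^4\,\eta_{i/2}^{-\gamma}+h_y^4\,\tilde\eta_{j/2}^{-\gamma}\right)+C\left(h_x^{5-\gamma}+h_y^{5-\gamma}\right),$$ where $\eta_{i/2}=\min\{x_{i/2}-a,\;b-x_{i/2}\}$ and $\tilde\eta_{j/2}=\min\{y_{j/2}-c,\;d-y_{j/2}\}$. -/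

import Mathlib

noncomputable section

namespace PQC

/-- Uniform step size `h = (b - a) / M`. -/
def step (a b : ℝ) (M : ℕ) : ℝ := (b - a) / M

/-- The mesh point `x_{k/2} = a + (k/2) h`, for `0 ≤ k ≤ 2M`. -/
def node (a b : ℝ) (M k : ℕ) : ℝ := a + (k : ℝ) / 2 * step a b M

open Classical in
/-- The piecewise quadratic basis function `φ_{k/2}`, `0 ≤ k ≤ 2M`, attached to the mesh point
`p = x_{k/2}`. For `k = 2l` the neighbours are `x_{l-1} = p - h` and `x_{l+1} = p + h`; for
`k = 2l - 1` the two ends of the element are `x_{l-1} = p - h/2` and `x_l = p + h/2`.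
For `k = 0` and `k = 2M` only the half of the support that lies in `[a, b]` matters. -/
def basisFun (a b : ℝ) (M k : ℕ) (x : ℝ) : ℝ :=
  let h := step a b M
  let p := node a b M k
  if Even k then
    if x ∈ Set.Icc (p - h) p then
      (x - (p - h)) / h * ((2 * x - (p + (p - h))) / h)
    else if x ∈ Set.Icc p (p + h) then
      ((p + h) - x) / h * (((p + h) + p - 2 * x) / h)
    else 0
  else
    if x ∈ Set.Icc (p - h / 2) (p + h / 2) then
      4 * (x - (p - h / 2)) * ((p + h / 2) - x) / h ^ 2
    else 0

/-- The piecewise biquadratic Lagrange interpolant `u_Q` of `u` on `[a, b] × [c, d]`. -/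
def interp (a b c d : ℝ) (Mx My : ℕ) (u : ℝ → ℝ → ℝ) (x y : ℝ) : ℝ :=
  ∑ l ∈ Finset.range (2 * Mx + 1), ∑ r ∈ Finset.range (2 * My + 1),
    basisFun a b Mx l x * basisFun c d My r y * u (node a b Mx l) (node c d My r)

/-- `η_{k/2} = min {x_{k/2} - a, b - x_{k/2}}`. -/
def eta (a b : ℝ) (M k : ℕ) : ℝ := min (node a b M k - a) (b - node a b M k)

/-- The weighted interpolation error
`(u - u_Q)(x, y) / (|x_{i/2} - x| ^ γ * |y_{j/2} - y| ^ γ)`. -/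
def errIntegrand (γ a b c d : ℝ) (u : ℝ → ℝ → ℝ) (Mx My i j : ℕ) (x y : ℝ) : ℝ :=
  (u x y - interp a b c d Mx My u x y) /
    (|node a b Mx i - x| ^ γ * |node c d My j - y| ^ γ)

end PQC

end

/-!
On each element the interpolation error of a `C⁴` function of one variable is, up to `O(h⁴)`, its
third derivative at the midpoint times a cubic bubble, which is odd about the midpoint. All these
third derivatives may be replaced by the one at the singularity `ξ = x_{i/2}`: on an element at
distance `ρ` from `ξ` this costs a factor `O(ρ)`, but the weighted integral of the bubble gains a
factor `O(h / ρ)` from its vanishing mean. There remains the sum of the weighted bubble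
integrals. Those of elements symmetric about the node `ξ` cancel, and the remaining ones lie at
distance at least `η` from `ξ`, where, the weight being monotone, they telescope to `h⁴ η^{-γ}`.

In two variables, with `I` and `J` the interpolation operators in `x` and `y`, write
`u - I J u = (u - I u) + I (u - J u)` and apply the one-variable bound to the slices of `u`,
uniformly; the basis functions behind `I` have absolute values summing to at most `3`.
-/

namespace PQC

open MeasureTheory Set

section Weight

/-- The singular weight `x ↦ |ξ - x| ^ (-γ)`. -/
noncomputable def weight (γ ξ x : ℝ) : ℝ := |ξ - x| ^ (-γ)

variable {γ ξ p q : ℝ}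

lemma weight_nonneg (γ ξ x : ℝ) : 0 ≤ weight γ ξ x := Real.rpow_nonneg (abs_nonneg _) _

lemma weight_two_mul_sub (γ ξ x : ℝ) : weight γ ξ (2 * ξ - x) = weight γ ξ x := by
  rw [weight, weight, ← abs_neg]
  ring_nf

lemma weight_eq_of_le {x : ℝ} (hx : x ≤ ξ) : weight γ ξ x = (ξ - x) ^ (-γ) := by
  rw [weight, abs_of_nonneg (sub_nonneg.mpr hx)]

lemma weight_eq_of_ge {x : ℝ} (hx : ξ ≤ x) : weight γ ξ x = (x - ξ) ^ (-γ) := by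
  rw [weight, abs_sub_comm, abs_of_nonneg (sub_nonneg.mpr hx)]

lemma antitoneOn_weight (hγ : 0 ≤ γ) : AntitoneOn (weight γ ξ) (Ioi ξ) := by
  intro x hx y hy hxy
  rw [mem_Ioi] at hx hy
  rw [weight_eq_of_ge hx.le, weight_eq_of_ge hy.le]
  exact Real.rpow_le_rpow_of_nonpos (by linarith) (by linarith) (by linarith)

lemma intervalIntegrable_weight (hγ : γ < 1) (ξ p q : ℝ) :
    IntervalIntegrable (weight γ ξ) volume p q := by
  have hpow (r s : ℝ) : IntervalIntegrable (fun x : ℝ ↦ x ^ (-γ)) volume r s :=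
    intervalIntegral.intervalIntegrable_rpow' (by linarith)
  have right (r : ℝ) (hr : ξ ≤ r) : IntervalIntegrable (weight γ ξ) volume ξ r := by
    have := (hpow 0 (r - ξ)).comp_sub_right ξ
    simp only [zero_add, sub_add_cancel] at this
    refine this.congr fun x hx ↦ ?_
    rw [uIoc_of_le hr] at hx
    exact (weight_eq_of_ge hx.1.le).symm
  have any (r : ℝ) : IntervalIntegrable (weight γ ξ) volume ξ r := by
    rcases le_total ξ r with hr | hr
    · exact right r hr
    · have := (right (2 * ξ - r) (by linarith)).comp_sub_left (2 * ξ)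
      rwa [funext (weight_two_mul_sub γ ξ), sub_sub_cancel, two_mul, add_sub_cancel_right] at this
  exact (any p).symm.trans (any q)

lemma integral_weight_nonneg (hpq : p ≤ q) : 0 ≤ ∫ x in p..q, weight γ ξ x :=
  intervalIntegral.integral_nonneg hpq fun _ _ ↦ weight_nonneg _ _ _

lemma integral_weight (hγ : γ < 1) (hξ : ξ ∈ Icc p q) :
    ∫ x in p..q, weight γ ξ x = ((ξ - p) ^ (1 - γ) + (q - ξ) ^ (1 - γ)) / (1 - γ) := by
  have hpow (r : ℝ) : ∫ s in (0 : ℝ)..r, s ^ (-γ) = r ^ (1 - γ) / (1 - γ) := by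
    rw [integral_rpow (Or.inl (by linarith)), neg_add_eq_sub,
      Real.zero_rpow (by linarith), sub_zero]
  have left : ∫ x in p..ξ, weight γ ξ x = (ξ - p) ^ (1 - γ) / (1 - γ) := by
    rw [← hpow, ← sub_self ξ,
      ← intervalIntegral.integral_comp_sub_left (fun s : ℝ ↦ s ^ (-γ)) ξ]
    refine intervalIntegral.integral_congr fun x hx ↦ ?_
    rw [uIcc_of_le hξ.1] at hx
    exact weight_eq_of_le hx.2
  have right : ∫ x in ξ..q, weight γ ξ x = (q - ξ) ^ (1 - γ) / (1 - γ) := by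
    rw [← hpow, ← sub_self ξ,
      ← intervalIntegral.integral_comp_sub_right (fun s : ℝ ↦ s ^ (-γ)) ξ]
    refine intervalIntegral.integral_congr fun x hx ↦ ?_
    rw [uIcc_of_le hξ.2] at hx
    exact weight_eq_of_ge hx.1
  rw [← intervalIntegral.integral_add_adjacent_intervals (intervalIntegrable_weight hγ ξ p ξ)
    (intervalIntegrable_weight hγ ξ ξ q), left, right, add_div]

lemma integral_weight_le (hγ : γ < 1) (hξ : ξ ∈ Icc p q) :
    ∫ x in p..q, weight γ ξ x ≤ 2 * (q - p) ^ (1 - γ) / (1 - γ) := by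
  have hexp : 0 ≤ 1 - γ := sub_nonneg.mpr hγ.le
  have hleft := Real.rpow_le_rpow (sub_nonneg.mpr hξ.1) (sub_le_sub_right hξ.2 p) hexp
  have hright := Real.rpow_le_rpow (sub_nonneg.mpr hξ.2) (sub_le_sub_left hξ.1 q) hexp
  rw [integral_weight hγ hξ, two_mul]
  exact div_le_div_of_nonneg_right (add_le_add hleft hright) hexp

lemma abs_integral_mul_weight_le (hγ : γ < 1) (hpq : p ≤ q) {f : ℝ → ℝ} {B : ℝ}
    (hf : ∀ x ∈ Icc p q, |f x| ≤ B) :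
    |∫ x in p..q, f x * weight γ ξ x| ≤ B * ∫ x in p..q, weight γ ξ x := by
  rw [← intervalIntegral.integral_const_mul, ← Real.norm_eq_abs]
  refine intervalIntegral.norm_integral_le_of_norm_le hpq
    (Filter.Eventually.of_forall fun x hx ↦ ?_) ((intervalIntegrable_weight hγ ξ _ _).const_mul _)
  rw [Real.norm_eq_abs, abs_mul, abs_of_nonneg (weight_nonneg _ _ _)]
  exact mul_le_mul_of_nonneg_right (hf x ⟨hx.1.le, hx.2⟩) (weight_nonneg _ _ _)

end Weight

section Bubble

/-- The error of quadratic interpolation of the cubic monomial on `[p, p + h]`: the monic cubic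
vanishing at the two ends and at the midpoint. -/
noncomputable def bubble (p h x : ℝ) : ℝ := (x - p) * (x - (p + h / 2)) * (x - (p + h))

/-- The weighted integral of `bubble p h` over `[p, p + h]`, that is, the contribution of one
element to the weighted interpolation error of a cubic. -/
noncomputable def bubbleMoment (γ ξ h p : ℝ) : ℝ := ∫ x in p..p + h, bubble p h x * weight γ ξ x

variable {γ ξ p h : ℝ}

lemma continuous_bubble (p h : ℝ) : Continuous (bubble p h) := by unfold bubble; fun_prop

lemma abs_bubble_le {x : ℝ} (hx : x ∈ Icc p (p + h)) : |bubble p h x| ≤ h ^ 3 := by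
  have hdist (z : ℝ) (hz : z ∈ Icc p (p + h)) : |x - z| ≤ h :=
    abs_le.mpr ⟨by linarith [hx.1, hz.2], by linarith [hx.2, hz.1]⟩
  have hh : 0 ≤ h := by linarith [hx.1, hx.2]
  rw [bubble, abs_mul, abs_mul, pow_three']
  gcongr
  · exact hdist _ ⟨le_rfl, by linarith⟩
  · exact hdist _ ⟨by linarith, by linarith⟩
  · exact hdist _ ⟨by linarith, le_rfl⟩

lemma integral_bubble (p h : ℝ) : ∫ x in p..p + h, bubble p h x = 0 := by
  have primitive : ∀ x ∈ uIcc p (p + h),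
      HasDerivAt (fun x ↦ ((x - p) * (x - (p + h))) ^ 2 / 4) (bubble p h x) x := by
    intro x _
    refine ((((hasDerivAt_id x).sub_const p).mul
      ((hasDerivAt_id x).sub_const (p + h))).pow 2 |>.div_const 4).congr_deriv ?_
    simp only [bubble, Pi.mul_apply, id]
    ring
  rw [intervalIntegral.integral_eq_sub_of_hasDerivAt primitive
    ((continuous_bubble p h).intervalIntegrable _ _)]
  ring

lemma intervalIntegrable_bubble_mul_weight (hγ : γ < 1) (ξ p h r s : ℝ) :
    IntervalIntegrable (fun x ↦ bubble p h x * weight γ ξ x) volume r s :=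
  (intervalIntegrable_weight hγ ξ r s).continuousOn_mul (continuous_bubble p h).continuousOn

lemma integral_weight_reflect (γ ξ h p : ℝ) :
    ∫ x in (2 * ξ - (p + h))..(2 * ξ - (p + h) + h), weight γ ξ x =
      ∫ x in p..p + h, weight γ ξ x := by
  have := intervalIntegral.integral_comp_sub_left (a := p) (b := p + h) (weight γ ξ) (2 * ξ)
  simp only [weight_two_mul_sub] at this
  rw [this, sub_add, add_sub_cancel_right]

lemma bubbleMoment_reflect (γ ξ h p : ℝ) :
    bubbleMoment γ ξ h (2 * ξ - (p + h)) = -bubbleMoment γ ξ h p := by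
  have odd (x : ℝ) : bubble (2 * ξ - (p + h)) h (2 * ξ - x) = -bubble p h x := by
    simp only [bubble]
    ring
  have := intervalIntegral.integral_comp_sub_left (a := p) (b := p + h)
    (fun x ↦ bubble (2 * ξ - (p + h)) h x * weight γ ξ x) (2 * ξ)
  simp only [odd, weight_two_mul_sub, neg_mul, intervalIntegral.integral_neg] at this
  rw [bubbleMoment, bubbleMoment, this]
  ring_nf

lemma abs_bubbleMoment_le (hγ : γ < 1) (hh : 0 ≤ h) :
    |bubbleMoment γ ξ h p| ≤ h ^ 3 * ∫ x in p..p + h, weight γ ξ x :=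
  abs_integral_mul_weight_le hγ (by linarith) fun _ ↦ abs_bubble_le

-- As `bubble p h` has mean zero, the constant `weight γ ξ p` can be subtracted from the weight.
lemma abs_bubbleMoment_le_sub (hγ0 : 0 ≤ γ) (hγ1 : γ < 1) (hh : 0 ≤ h) (hp : ξ < p) :
    |bubbleMoment γ ξ h p| ≤ h ^ 4 * (weight γ ξ p - weight γ ξ (p + h)) := by
  have centred : bubbleMoment γ ξ h p =
      ∫ x in p..p + h, bubble p h x * (weight γ ξ x - weight γ ξ p) := by
    simp only [mul_sub]
    rw [intervalIntegral.integral_sub (intervalIntegrable_bubble_mul_weight hγ1 _ _ _ _ _)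
      (((continuous_bubble p h).mul_const _).intervalIntegrable _ _),
      intervalIntegral.integral_mul_const, integral_bubble, zero_mul, sub_zero, bubbleMoment]
  rw [centred, ← Real.norm_eq_abs]
  refine (intervalIntegral.norm_integral_le_of_norm_le_const
    (C := h ^ 3 * (weight γ ξ p - weight γ ξ (p + h))) fun x hx ↦ ?_).trans_eq ?_
  · rw [uIoc_of_le (by linarith)] at hx
    have hxξ : ξ < x := hp.trans hx.1
    have hw := antitoneOn_weight hγ0 hp hxξ hx.1.le
    have hw' := antitoneOn_weight hγ0 hxξ (hxξ.trans_le hx.2) hx.2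
    rw [Real.norm_eq_abs, abs_mul]
    gcongr
    · exact abs_bubble_le ⟨hx.1.le, hx.2⟩
    · rw [abs_le]
      constructor <;> linarith
  · rw [add_sub_cancel_left, abs_of_nonneg hh]
    ring

lemma sum_bubbleMoment_reflect (γ ξ h p : ℝ) (n : ℕ) :
    ∑ l ∈ Finset.range n, bubbleMoment γ ξ h (2 * ξ - (p + n * h) + l * h) =
      -∑ l ∈ Finset.range n, bubbleMoment γ ξ h (p + l * h) := by
  rw [← Finset.sum_range_reflect, ← Finset.sum_neg_distrib]
  refine Finset.sum_congr rfl fun l hl ↦ ?_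
  have hl := Finset.mem_range.mp hl
  rw [← bubbleMoment_reflect, Nat.sub_sub, Nat.cast_sub (by omega)]
  congr 1
  push_cast
  ring

lemma sum_bubbleMoment_eq_zero (γ h p : ℝ) (i : ℕ) :
    ∑ l ∈ Finset.range i, bubbleMoment γ (p + i / 2 * h) h (p + l * h) = 0 := by
  have := sum_bubbleMoment_reflect γ (p + i / 2 * h) h p i
  rw [show 2 * (p + i / 2 * h) - (p + i * h) = p by ring] at this
  exact self_eq_neg.mp this

lemma sum_abs_bubbleMoment_le (hγ0 : 0 ≤ γ) (hγ1 : γ < 1) (hh : 0 ≤ h) (hp : ξ < p) (n : ℕ) :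
    ∑ l ∈ Finset.range n, |bubbleMoment γ ξ h (p + l * h)| ≤ h ^ 4 * weight γ ξ p := by
  have drop (l : ℕ) : |bubbleMoment γ ξ h (p + l * h)| ≤
      h ^ 4 * weight γ ξ (p + l * h) - h ^ 4 * weight γ ξ (p + (l + 1 : ℕ) * h) := by
    refine (abs_bubbleMoment_le_sub hγ0 hγ1 hh (by nlinarith [l.cast_nonneg (α := ℝ)])).trans_eq ?_
    push_cast
    ring_nf
  calc ∑ l ∈ Finset.range n, |bubbleMoment γ ξ h (p + l * h)|
      ≤ h ^ 4 * weight γ ξ (p + (0 : ℕ) * h) - h ^ 4 * weight γ ξ (p + n * h) :=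
        (Finset.sum_le_sum fun l _ ↦ drop l).trans_eq
          (Finset.sum_range_sub' (fun l : ℕ ↦ h ^ 4 * weight γ ξ (p + l * h)) n)
    _ ≤ h ^ 4 * weight γ ξ p := by
        have := weight_nonneg γ ξ (p + n * h)
        rw [Nat.cast_zero, zero_mul, add_zero]
        exact sub_le_self _ (by positivity)

-- The elements `l` and `i - 1 - l` are mirror images in `p + i / 2 * h`, so the first `i` moments
-- cancel; the remaining elements lie to the right of the singularity.
lemma abs_sum_bubbleMoment_le (hγ0 : 0 ≤ γ) (hγ1 : γ < 1) (hh : 0 < h) {i n : ℕ} (hi : 0 < i)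
    (hin : i ≤ n) :
    |∑ l ∈ Finset.range n, bubbleMoment γ (p + i / 2 * h) h (p + l * h)| ≤
      h ^ 4 * (i / 2 * h) ^ (-γ) := by
  obtain ⟨m, rfl⟩ := Nat.exists_eq_add_of_le hin
  have hpos : 0 < i / 2 * h := by positivity
  have tail := sum_abs_bubbleMoment_le hγ0 hγ1 hh.le
    (by linarith : p + i / 2 * h < p + i * h) m
  rw [weight_eq_of_ge (by linarith), show p + i * h - (p + i / 2 * h) = i / 2 * h by ring] at tail
  rw [Finset.sum_range_add, sum_bubbleMoment_eq_zero, zero_add]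
  simpa only [Nat.cast_add, add_mul, add_assoc] using (Finset.abs_sum_le_sum_abs _ _).trans tail

-- At distance `ρ = p - ξ ≥ h / 2` from the singularity,
-- `(ρ + h) * (((ρ + h) / ρ) ^ γ - 1) ≤ (ρ + h) * h / ρ ≤ 3 * h`.
lemma sub_mul_weight_sub_le (hγ0 : 0 ≤ γ) (hγ1 : γ < 1) (hh : 0 < h) (hp : h / 2 ≤ p - ξ) :
    (p + h - ξ) * (weight γ ξ p - weight γ ξ (p + h)) ≤ 3 * ∫ x in p..p + h, weight γ ξ x := by
  have hρ : 0 < p - ξ := by linarith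
  have hρh : 0 < p + h - ξ := by linarith
  set r := (p + h - ξ) / (p - ξ) with hr
  have hr1 : 1 ≤ r := by rw [le_div_iff₀ hρ]; linarith
  have lower : h * weight γ ξ (p + h) ≤ ∫ x in p..p + h, weight γ ξ x := by
    have := intervalIntegral.integral_mono_on (a := p) (b := p + h) (by linarith)
      (intervalIntegrable_const (μ := volume) (c := weight γ ξ (p + h)))
      (intervalIntegrable_weight hγ1 ξ _ _) fun x hx ↦ antitoneOn_weight hγ0
        (by linarith [hx.1] : ξ < x) (by linarith : ξ < p + h) hx.2
    rwa [intervalIntegral.integral_const, add_sub_cancel_left, smul_eq_mul] at this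
  have ratio : weight γ ξ p = r ^ γ * weight γ ξ (p + h) := by
    rw [weight_eq_of_ge (by linarith), weight_eq_of_ge (by linarith), hr,
      Real.div_rpow hρh.le hρ.le, Real.rpow_neg hρ.le, Real.rpow_neg hρh.le]
    have := (Real.rpow_pos_of_pos hρh γ).ne'
    field_simp
  have hrγ : r ^ γ ≤ r := by simpa using Real.rpow_le_rpow_of_exponent_le hr1 hγ1.le
  have h3 : (p + h - ξ) * (r - 1) ≤ 3 * h := by
    rw [show (p + h - ξ) * (r - 1) = (p + h - ξ) * h / (p - ξ) by rw [hr]; field_simp; ring,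
      div_le_iff₀ hρ]
    nlinarith
  have hw := weight_nonneg γ ξ (p + h)
  calc (p + h - ξ) * (weight γ ξ p - weight γ ξ (p + h))
      = (p + h - ξ) * (r ^ γ - 1) * weight γ ξ (p + h) := by rw [ratio]; ring
    _ ≤ (p + h - ξ) * (r - 1) * weight γ ξ (p + h) := by gcongr
    _ ≤ 3 * h * weight γ ξ (p + h) := by gcongr
    _ ≤ 3 * ∫ x in p..p + h, weight γ ξ x := by rw [mul_assoc]; gcongr

lemma abs_sub_mul_abs_bubbleMoment_le_of_lt (hγ0 : 0 ≤ γ) (hγ1 : γ < 1) (hh : 0 < h)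
    (hp : h / 2 ≤ p - ξ) :
    |p + h / 2 - ξ| * |bubbleMoment γ ξ h p| ≤ 3 * h ^ 4 * ∫ x in p..p + h, weight γ ξ x := by
  have hmoment := abs_bubbleMoment_le_sub hγ0 hγ1 hh.le (by linarith : ξ < p)
  have hosc := sub_mul_weight_sub_le hγ0 hγ1 hh hp
  rw [abs_of_pos (by linarith : 0 < p + h / 2 - ξ)]
  calc (p + h / 2 - ξ) * |bubbleMoment γ ξ h p|
      ≤ (p + h - ξ) * (h ^ 4 * (weight γ ξ p - weight γ ξ (p + h))) := by gcongr <;> linarith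
    _ = h ^ 4 * ((p + h - ξ) * (weight γ ξ p - weight γ ξ (p + h))) := by ring
    _ ≤ h ^ 4 * (3 * ∫ x in p..p + h, weight γ ξ x) := by gcongr
    _ = 3 * h ^ 4 * ∫ x in p..p + h, weight γ ξ x := by ring

lemma abs_sub_mul_abs_bubbleMoment_le (hγ0 : 0 ≤ γ) (hγ1 : γ < 1) (hh : 0 < h)
    (hξ : h / 2 ≤ p - ξ ∨ ξ ∈ Icc p (p + h) ∨ h / 2 ≤ ξ - (p + h)) :
    |p + h / 2 - ξ| * |bubbleMoment γ ξ h p| ≤ 3 * h ^ 4 * ∫ x in p..p + h, weight γ ξ x := by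
  rcases hξ with left | inside | right
  · exact abs_sub_mul_abs_bubbleMoment_le_of_lt hγ0 hγ1 hh left
  · have hdist : |p + h / 2 - ξ| ≤ h :=
      abs_le.mpr ⟨by linarith [inside.2], by linarith [inside.1]⟩
    have hW := integral_weight_nonneg (γ := γ) (ξ := ξ) (by linarith : p ≤ p + h)
    calc |p + h / 2 - ξ| * |bubbleMoment γ ξ h p|
        ≤ h * (h ^ 3 * ∫ x in p..p + h, weight γ ξ x) := by
          gcongr; exact abs_bubbleMoment_le hγ1 hh.le
      _ = 1 * h ^ 4 * ∫ x in p..p + h, weight γ ξ x := by ring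
      _ ≤ 3 * h ^ 4 * ∫ x in p..p + h, weight γ ξ x := by gcongr; norm_num
  · have := abs_sub_mul_abs_bubbleMoment_le_of_lt (ξ := ξ) (p := 2 * ξ - (p + h)) hγ0 hγ1 hh
      (by linarith)
    rwa [bubbleMoment_reflect, integral_weight_reflect, abs_neg,
      show 2 * ξ - (p + h) + h / 2 - ξ = -(p + h / 2 - ξ) by ring, abs_neg] at this

end Bubble

section Mesh

variable {γ a b x : ℝ} {M i k l : ℕ}

lemma step_pos (hab : a < b) (hM : 1 ≤ M) : 0 < step a b M :=
  div_pos (sub_pos.mpr hab) (Nat.cast_pos.mpr hM)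

lemma mul_step (a b : ℝ) (hM : 1 ≤ M) : M * step a b M = b - a :=
  mul_div_cancel₀ _ (Nat.cast_ne_zero.mpr (by omega))

lemma node_succ (a b : ℝ) (M k : ℕ) : node a b M (k + 1) = node a b M k + step a b M / 2 := by
  rw [node, node]
  push_cast
  ring

lemma node_add_two (a b : ℝ) (M k : ℕ) : node a b M (k + 2) = node a b M k + step a b M := by
  rw [node_succ, node_succ, add_assoc, add_halves]

lemma node_two_mul (a b : ℝ) (M l : ℕ) : node a b M (2 * l) = a + l * step a b M := by
  rw [node]
  push_cast
  ring

lemma node_two_mul_self (a b : ℝ) (hM : 1 ≤ M) : node a b M (2 * M) = b := by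
  rw [node_two_mul, mul_step a b hM, add_sub_cancel]

lemma strictMono_node (hab : a < b) (hM : 1 ≤ M) : StrictMono (node a b M) := by
  intro k l hkl
  have := step_pos hab hM
  unfold node
  gcongr

lemma node_mem_Icc (hab : a < b) (hM : 1 ≤ M) (hk : k ≤ 2 * M) : node a b M k ∈ Icc a b := by
  have hmono := (strictMono_node hab hM).monotone
  exact ⟨by simpa [node] using hmono k.zero_le, (hmono hk).trans_eq (node_two_mul_self a b hM)⟩

lemma element_subset_Icc (hab : a < b) (hM : 1 ≤ M) (hl : l < M) :
    Icc (node a b M (2 * l)) (node a b M (2 * l) + step a b M) ⊆ Icc a b := by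
  rw [← node_add_two]
  exact Icc_subset_Icc (node_mem_Icc hab hM (by omega)).1 (node_mem_Icc hab hM (by omega)).2

lemma node_left_or_inside_or_right (hab : a < b) (hM : 1 ≤ M) (i l : ℕ) :
    step a b M / 2 ≤ node a b M (2 * l) - node a b M i ∨
      node a b M i ∈ Icc (node a b M (2 * l)) (node a b M (2 * l) + step a b M) ∨
      step a b M / 2 ≤ node a b M i - (node a b M (2 * l) + step a b M) := by
  have hmono := (strictMono_node hab hM).monotone
  have hsucc := node_succ a b M
  rw [← node_add_two]
  rcases lt_or_ge i (2 * l) with hi | hi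
  · left
    linarith [hmono (Nat.succ_le_of_lt hi), hsucc i]
  · rcases le_or_gt i (2 * l + 2) with hi' | hi'
    · exact Or.inr (Or.inl ⟨hmono hi, hmono hi'⟩)
    · right; right
      linarith [hmono (Nat.succ_le_of_lt hi'), hsucc (2 * l + 2)]

lemma exists_element (hab : a < b) (hM : 1 ≤ M) (hx : x ∈ Icc a b) :
    ∃ l < M, ∃ t ∈ Icc (0 : ℝ) 1, x = node a b M (2 * l) + t * step a b M := by
  have h := step_pos hab hM
  have e := mul_step a b hM
  simp only [node_two_mul]
  rcases hx.2.eq_or_lt with rfl | hxb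
  · refine ⟨M - 1, by omega, 1, by simp, ?_⟩
    push_cast [Nat.cast_sub hM]
    linarith
  · have hq : 0 ≤ (x - a) / step a b M := div_nonneg (by linarith [hx.1]) h.le
    refine ⟨⌊(x - a) / step a b M⌋₊, ?_, Int.fract ((x - a) / step a b M),
      ⟨Int.fract_nonneg _, (Int.fract_lt_one _).le⟩, ?_⟩
    · rw [Nat.floor_lt hq, div_lt_iff₀ h]
      linarith
    · rw [natCast_floor_eq_intCast_floor hq, add_assoc, ← add_mul, Int.floor_add_fract,
        div_mul_cancel₀ _ h.ne', add_sub_cancel]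

lemma sum_integral_elements (hab : a < b) (hM : 1 ≤ M) {f : ℝ → ℝ}
    (hf : IntervalIntegrable f volume a b) :
    ∑ l ∈ Finset.range M, ∫ x in node a b M (2 * l)..node a b M (2 * l) + step a b M, f x =
      ∫ x in a..b, f x := by
  have sum := intervalIntegral.sum_integral_adjacent_intervals (f := f) (μ := volume) (n := M)
    (a := fun l ↦ node a b M (2 * l)) fun l hl ↦ hf.mono_set ?_
  · simpa only [mul_add_one, node_add_two, node_two_mul_self a b hM, mul_zero,
      show node a b M 0 = a by simp [node]] using sum
  · rw [uIcc_of_le hab.le]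
    exact uIcc_subset_Icc (node_mem_Icc hab hM (by omega)) (node_mem_Icc hab hM (by omega))

lemma eta_pos (hab : a < b) (hM : 1 ≤ M) (hi : 1 ≤ i) (hiM : i < 2 * M) : 0 < eta a b M i := by
  refine lt_min (sub_pos.mpr ?_) (sub_pos.mpr ?_)
  · simpa [node] using strictMono_node hab hM hi
  · simpa only [node_two_mul_self a b hM] using strictMono_node hab hM hiM

lemma integral_weight_node_le (hγ0 : 0 ≤ γ) (hγ1 : γ < 1) (hab : a < b) (hM : 1 ≤ M) (hi : 1 ≤ i)
    (hiM : i < 2 * M) :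
    ∫ x in a..b, weight γ (node a b M i) x ≤ 2 * (b - a) / (1 - γ) * eta a b M i ^ (-γ) := by
  have hη := eta_pos hab hM hi hiM
  have hξ := node_mem_Icc hab hM hiM.le
  have hηle : eta a b M i ≤ b - a := (min_le_left _ _).trans (by linarith [hξ.2])
  have : 0 < 1 - γ := sub_pos.mpr hγ1
  have hba : 0 < b - a := sub_pos.mpr hab
  calc ∫ x in a..b, weight γ (node a b M i) x
      ≤ 2 * (b - a) ^ (1 - γ) / (1 - γ) := integral_weight_le hγ1 hξ
    _ = 2 * (b - a) / (1 - γ) * (b - a) ^ (-γ) := by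
        rw [sub_eq_add_neg 1 γ, Real.rpow_one_add' hba.le (by linarith)]
        ring
    _ ≤ 2 * (b - a) / (1 - γ) * eta a b M i ^ (-γ) := by
        gcongr ?_ * ?_
        exact Real.rpow_le_rpow_of_nonpos hη hηle (by linarith)

lemma abs_sum_bubbleMoment_node_le (hγ0 : 0 ≤ γ) (hγ1 : γ < 1) (hab : a < b) (hM : 1 ≤ M)
    (hi : 1 ≤ i) (hiM : i < 2 * M) :
    |∑ l ∈ Finset.range M, bubbleMoment γ (node a b M i) (step a b M) (node a b M (2 * l))| ≤
      step a b M ^ 4 * eta a b M i ^ (-γ) := by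
  have h := step_pos hab hM
  have e := mul_step a b hM
  have hη := eta_pos hab hM hi hiM
  simp only [node_two_mul]
  rcases le_total i M with hle | hle
  · refine (abs_sum_bubbleMoment_le hγ0 hγ1 h hi hle).trans ?_
    gcongr ?_ * ?_
    exact Real.rpow_le_rpow_of_nonpos hη ((min_le_left _ _).trans_eq (by rw [node]; ring))
      (by linarith)
  · set ξ := node a b M i with hξ
    have mirror : ξ = 2 * ξ - (a + M * step a b M) + (2 * M - i : ℕ) / 2 * step a b M := by
      rw [Nat.cast_sub hiM.le, hξ, node]
      push_cast
      ring
    have bound := abs_sum_bubbleMoment_le (p := 2 * ξ - (a + M * step a b M)) hγ0 hγ1 h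
      (by omega : 0 < 2 * M - i) (by omega : 2 * M - i ≤ M)
    rw [← mirror, sum_bubbleMoment_reflect, abs_neg] at bound
    refine bound.trans ?_
    gcongr ?_ * ?_
    exact Real.rpow_le_rpow_of_nonpos hη ((min_le_right _ _).trans_eq (by linarith))
      (by linarith)

end Mesh

section BasisFun

variable {a b t x : ℝ} {M k l : ℕ}

lemma measurable_basisFun (a b : ℝ) (M k : ℕ) : Measurable (basisFun a b M k) := by
  unfold basisFun
  dsimp only
  split_ifs
  · exact Measurable.ite measurableSet_Icc (by fun_prop)
      (Measurable.ite measurableSet_Icc (by fun_prop) measurable_const)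
  · exact Measurable.ite measurableSet_Icc (by fun_prop) measurable_const

lemma basisFun_node_add (hk : Even k) (h : 0 < step a b M) (ht : t ∈ Icc (0 : ℝ) 1) :
    basisFun a b M k (node a b M k + t * step a b M) = (1 - t) * (1 - 2 * t) := by
  obtain ⟨ht0, ht1⟩ := ht
  simp only [basisFun, if_pos hk]
  split_ifs with hleft hright
  · obtain rfl : t = 0 := by nlinarith [hleft.2]
    field_simp
    ring
  · field_simp
    ring
  · exact absurd ⟨by nlinarith, by nlinarith⟩ hright

lemma basisFun_node_sub_add (hk : Even k) (h : 0 < step a b M) (ht : t ∈ Icc (0 : ℝ) 1) :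
    basisFun a b M k (node a b M k - step a b M + t * step a b M) = t * (2 * t - 1) := by
  obtain ⟨ht0, ht1⟩ := ht
  simp only [basisFun, if_pos hk]
  rw [if_pos ⟨by nlinarith, by nlinarith⟩]
  field_simp
  ring

lemma basisFun_node_sub_half_add (hk : ¬ Even k) (h : 0 < step a b M) (ht : t ∈ Icc (0 : ℝ) 1) :
    basisFun a b M k (node a b M k - step a b M / 2 + t * step a b M) = 4 * t * (1 - t) := by
  obtain ⟨ht0, ht1⟩ := ht
  simp only [basisFun, if_neg hk]
  rw [if_pos ⟨by nlinarith, by nlinarith⟩]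
  field_simp
  ring

lemma basisFun_eq_zero_of_even (hk : Even k) (hx : step a b M ≤ |x - node a b M k|) :
    basisFun a b M k x = 0 := by
  simp only [basisFun, if_pos hk]
  split_ifs with hleft hright
  · rw [abs_of_nonpos (by linarith [hleft.2])] at hx
    obtain rfl : x = node a b M k - step a b M := le_antisymm (by linarith) hleft.1
    simp
  · rw [abs_of_nonneg (by linarith [hright.1])] at hx
    obtain rfl : x = node a b M k + step a b M := le_antisymm hright.2 (by linarith)
    simp
  · rfl

lemma basisFun_eq_zero_of_not_even (hk : ¬ Even k) (hx : step a b M / 2 ≤ |x - node a b M k|) :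
    basisFun a b M k x = 0 := by
  simp only [basisFun, if_neg hk]
  split_ifs with hmem
  · rcases le_abs.mp hx with hright | hleft
    · obtain rfl : x = node a b M k + step a b M / 2 := le_antisymm hmem.2 (by linarith)
      simp
    · obtain rfl : x = node a b M k - step a b M / 2 := le_antisymm (by linarith) hmem.1
      simp
  · rfl

lemma basisFun_eq_zero_of_lt (hab : a < b) (hM : 1 ≤ M) (hk : k < 2 * l)
    (hx : node a b M (2 * l) ≤ x) : basisFun a b M k x = 0 := by
  have hmono := (strictMono_node hab hM).monotone
  by_cases he : Even k
  · have : k + 2 ≤ 2 * l := by grind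
    refine basisFun_eq_zero_of_even he ((le_abs_self _).trans' ?_)
    linarith [hmono this, node_add_two a b M k]
  · refine basisFun_eq_zero_of_not_even he ((le_abs_self _).trans' ?_)
    linarith [hmono (Nat.succ_le_of_lt hk), node_succ a b M k]

lemma basisFun_eq_zero_of_gt (hab : a < b) (hM : 1 ≤ M) (hk : 2 * l < k)
    (hx : x ≤ node a b M (2 * l)) : basisFun a b M k x = 0 := by
  have hmono := (strictMono_node hab hM).monotone
  by_cases he : Even k
  · have : 2 * l + 2 ≤ k := by grind
    refine basisFun_eq_zero_of_even he ((neg_le_abs _).trans' ?_)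
    linarith [hmono this, node_add_two a b M (2 * l)]
  · refine basisFun_eq_zero_of_not_even he ((neg_le_abs _).trans' ?_)
    linarith [hmono (Nat.succ_le_of_lt hk), node_succ a b M (2 * l)]

lemma sum_basisFun_mul (hab : a < b) (hM : 1 ≤ M) (hl : l < M) (ht : t ∈ Icc (0 : ℝ) 1)
    (F : ℕ → ℝ) :
    ∑ k ∈ Finset.range (2 * M + 1), basisFun a b M k (node a b M (2 * l) + t * step a b M) * F k =
      (1 - t) * (1 - 2 * t) * F (2 * l) + 4 * t * (1 - t) * F (2 * l + 1) +
        t * (2 * t - 1) * F (2 * l + 2) := by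
  have h := step_pos hab hM
  have heven : Even (2 * l) := even_two_mul l
  have left := basisFun_node_add heven h ht
  have middle := basisFun_node_sub_half_add (Nat.not_even_iff_odd.mpr heven.add_one) h ht
  have right := basisFun_node_sub_add (heven.add even_two) h ht
  rw [node_succ, add_sub_cancel_right] at middle
  rw [node_add_two, add_sub_cancel_right] at right
  have hsub : ({2 * l, 2 * l + 1, 2 * l + 2} : Finset ℕ) ⊆ Finset.range (2 * M + 1) := by
    intro k hk
    simp only [Finset.mem_insert, Finset.mem_singleton] at hk
    rw [Finset.mem_range]
    omega
  rw [← Finset.sum_subset hsub, Finset.sum_insert (by simp), Finset.sum_insert (by simp),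
    Finset.sum_singleton, left, middle, right, add_assoc]
  intro k _ hk
  simp only [Finset.mem_insert, Finset.mem_singleton, not_or] at hk
  rcases lt_or_ge k (2 * l) with hlt | hge
  · rw [basisFun_eq_zero_of_lt hab hM hlt (by nlinarith [ht.1]), zero_mul]
  · rw [basisFun_eq_zero_of_gt (l := l + 1) hab hM (by omega) ?_, zero_mul]
    rw [mul_add_one, node_add_two]
    nlinarith [ht.2]

lemma abs_quadratic_shape_combination_le {B y₀ y₁ y₂ : ℝ} (ht : t ∈ Icc (0 : ℝ) 1)
    (h₀ : |y₀| ≤ B) (h₁ : |y₁| ≤ B) (h₂ : |y₂| ≤ B) :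
    |(1 - t) * (1 - 2 * t) * y₀ + 4 * t * (1 - t) * y₁ + t * (2 * t - 1) * y₂| ≤ 3 * B := by
  obtain ⟨ht0, ht1⟩ := ht
  have left : |(1 - t) * (1 - 2 * t)| ≤ 1 := abs_le.mpr ⟨by nlinarith, by nlinarith⟩
  have middle : |4 * t * (1 - t)| ≤ 1 :=
    abs_le.mpr ⟨by nlinarith, by nlinarith [sq_nonneg (2 * t - 1)]⟩
  have right : |t * (2 * t - 1)| ≤ 1 := abs_le.mpr ⟨by nlinarith, by nlinarith⟩
  have mul_le {s y : ℝ} (hs : |s| ≤ 1) (hy : |y| ≤ B) : |s * y| ≤ B := by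
    rw [abs_mul, ← one_mul B]
    gcongr
  linarith [abs_add_three ((1 - t) * (1 - 2 * t) * y₀) (4 * t * (1 - t) * y₁)
    (t * (2 * t - 1) * y₂), mul_le left h₀, mul_le middle h₁, mul_le right h₂]

lemma abs_sum_basisFun_mul_le (hab : a < b) (hM : 1 ≤ M) (hx : x ∈ Icc a b) {F : ℕ → ℝ} {B : ℝ}
    (hF : ∀ k ≤ 2 * M, |F k| ≤ B) :
    |∑ k ∈ Finset.range (2 * M + 1), basisFun a b M k x * F k| ≤ 3 * B := by
  obtain ⟨l, hl, t, ht, rfl⟩ := exists_element hab hM hx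
  rw [sum_basisFun_mul hab hM hl ht]
  exact abs_quadratic_shape_combination_le ht (hF _ (by omega)) (hF _ (by omega))
    (hF _ (by omega))

lemma sum_abs_basisFun_le (hab : a < b) (hM : 1 ≤ M) (hx : x ∈ Icc a b) :
    ∑ k ∈ Finset.range (2 * M + 1), |basisFun a b M k x| ≤ 3 := by
  have hsign (k : ℕ) (_ : k ≤ 2 * M) : |(SignType.sign (basisFun a b M k x) : ℝ)| ≤ 1 := by
    rcases SignType.sign (basisFun a b M k x) <;> simp
  have := abs_sum_basisFun_mul_le hab hM hx hsign
  simp only [self_mul_sign, mul_one] at this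
  exact (le_abs_self _).trans this

lemma abs_basisFun_le (hab : a < b) (hM : 1 ≤ M) (hk : k ≤ 2 * M) (hx : x ∈ Icc a b) :
    |basisFun a b M k x| ≤ 3 :=
  (Finset.single_le_sum (f := fun k ↦ |basisFun a b M k x|) (fun _ _ ↦ abs_nonneg _)
    (Finset.mem_range.mpr (by omega))).trans (sum_abs_basisFun_le hab hM hx)

end BasisFun

section Interp₁

variable {a b x B K : ℝ} {M l n : ℕ} {f g : ℝ → ℝ}

lemma abs_iteratedDerivWithin_sub_le (hab : a < b) (hg : ContDiffOn ℝ (n + 1) g (Icc a b))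
    (hK : ∀ x ∈ Icc a b, |iteratedDerivWithin (n + 1) g (Icc a b) x| ≤ K) {m : ℝ}
    (hm : m ∈ Icc a b) (hx : x ∈ Icc a b) :
    |iteratedDerivWithin n g (Icc a b) x - iteratedDerivWithin n g (Icc a b) m| ≤
      K * |x - m| := by
  refine (convex_Icc a b).norm_image_sub_le_of_norm_derivWithin_le
    (hg.differentiableOn_iteratedDerivWithin ?_ (uniqueDiffOn_Icc hab)) (fun y hy ↦ ?_) hm hx
  · exact_mod_cast n.lt_succ_self
  · rw [← iteratedDerivWithin_succ]
    exact hK y hy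

-- The mean value theorem applied to the Taylor polynomial as a function of its centre, which
-- equals `g x` at the centre `x`.
lemma abs_sub_taylorWithinEval_le (hab : a < b) (hg : ContDiffOn ℝ (n + 1) g (Icc a b))
    (hK : ∀ x ∈ Icc a b, |iteratedDerivWithin (n + 1) g (Icc a b) x| ≤ K) {m : ℝ}
    (hm : m ∈ Icc a b) (hx : x ∈ Icc a b) :
    |g x - taylorWithinEval g n (Icc a b) m x| ≤ K * |x - m| ^ (n + 1) := by
  have hsub : uIcc m x ⊆ Icc a b := uIcc_subset_Icc hm hx
  have hdiff := hg.differentiableOn_iteratedDerivWithin (m := n)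
    (by exact_mod_cast n.lt_succ_self) (uniqueDiffOn_Icc hab)
  have bound : ∀ y ∈ uIcc m x, ‖((n.factorial : ℝ)⁻¹ * (x - y) ^ n) •
      iteratedDerivWithin (n + 1) g (Icc a b) y‖ ≤ |x - m| ^ n * K := by
    intro y hy
    have hfac : (n.factorial : ℝ)⁻¹ ≤ 1 :=
      inv_le_one_of_one_le₀ (by exact_mod_cast n.factorial_pos)
    rw [norm_smul, norm_mul, norm_pow, Real.norm_of_nonneg (by positivity)]
    refine mul_le_mul ?_ (hK y (hsub hy)) (abs_nonneg _) (by positivity)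
    refine (mul_le_of_le_one_left (by positivity) hfac).trans ?_
    gcongr
    exact abs_sub_right_of_mem_uIcc hy
  have mvt := (convex_uIcc m x).norm_image_sub_le_of_norm_hasDerivWithin_le
    (fun y hy ↦ (hasDerivWithinAt_taylorWithinEval_at_Icc x hab (hsub hy) hg.of_succ hdiff).mono
      hsub) bound left_mem_uIcc right_mem_uIcc
  rw [taylorWithinEval_self, Real.norm_eq_abs, Real.norm_eq_abs] at mvt
  exact mvt.trans_eq (by ring)

/-- The piecewise quadratic Lagrange interpolant of `g` on `[a, b]`. -/
noncomputable def interp₁ (a b : ℝ) (M : ℕ) (g : ℝ → ℝ) (x : ℝ) : ℝ :=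
  ∑ k ∈ Finset.range (2 * M + 1), basisFun a b M k x * g (node a b M k)

lemma interp₁_node_add (hab : a < b) (hM : 1 ≤ M) (hl : l < M) {t : ℝ} (ht : t ∈ Icc (0 : ℝ) 1)
    (g : ℝ → ℝ) :
    interp₁ a b M g (node a b M (2 * l) + t * step a b M) =
      (1 - t) * (1 - 2 * t) * g (node a b M (2 * l)) +
        4 * t * (1 - t) * g (node a b M (2 * l) + step a b M / 2) +
        t * (2 * t - 1) * g (node a b M (2 * l) + step a b M) := by
  rw [interp₁, sum_basisFun_mul hab hM hl ht fun k ↦ g (node a b M k), node_succ, node_add_two]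

lemma exists_eq_node_add (hab : a < b) (hM : 1 ≤ M)
    (hx : x ∈ Icc (node a b M (2 * l)) (node a b M (2 * l) + step a b M)) :
    ∃ t ∈ Icc (0 : ℝ) 1, x = node a b M (2 * l) + t * step a b M := by
  have h := step_pos hab hM
  refine ⟨(x - node a b M (2 * l)) / step a b M,
    ⟨div_nonneg (by linarith [hx.1]) h.le, (div_le_one h).mpr (by linarith [hx.2])⟩, ?_⟩
  rw [div_mul_cancel₀ _ h.ne', add_sub_cancel]

lemma sub_interp₁_cubic (hab : a < b) (hM : 1 ≤ M) (hl : l < M)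
    (hx : x ∈ Icc (node a b M (2 * l)) (node a b M (2 * l) + step a b M)) (m c₀ c₁ c₂ c₃ : ℝ) :
    c₀ + c₁ * (x - m) + c₂ * (x - m) ^ 2 + c₃ * (x - m) ^ 3 -
        interp₁ a b M (fun z ↦ c₀ + c₁ * (z - m) + c₂ * (z - m) ^ 2 + c₃ * (z - m) ^ 3) x =
      c₃ * bubble (node a b M (2 * l)) (step a b M) x := by
  obtain ⟨t, ht, rfl⟩ := exists_eq_node_add hab hM hx
  rw [interp₁_node_add hab hM hl ht, bubble]
  ring

lemma abs_interp₁_sub_le (hab : a < b) (hM : 1 ≤ M) (hl : l < M)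
    (hx : x ∈ Icc (node a b M (2 * l)) (node a b M (2 * l) + step a b M))
    (hfg : ∀ z ∈ Icc (node a b M (2 * l)) (node a b M (2 * l) + step a b M), |f z - g z| ≤ B) :
    |interp₁ a b M f x - interp₁ a b M g x| ≤ 3 * B := by
  have h := step_pos hab hM
  obtain ⟨t, ht, rfl⟩ := exists_eq_node_add hab hM hx
  rw [interp₁_node_add hab hM hl ht, interp₁_node_add hab hM hl ht]
  have left := hfg (node a b M (2 * l)) ⟨le_rfl, by linarith⟩
  have mid := hfg (node a b M (2 * l) + step a b M / 2) ⟨by linarith, by linarith⟩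
  have right := hfg (node a b M (2 * l) + step a b M) ⟨by linarith, le_rfl⟩
  refine le_of_eq_of_le ?_ (abs_quadratic_shape_combination_le ht left mid right)
  ring_nf

lemma taylorWithinEval_three (g : ℝ → ℝ) (s : Set ℝ) (m x : ℝ) :
    taylorWithinEval g 3 s m x = g m + iteratedDerivWithin 1 g s m * (x - m) +
      iteratedDerivWithin 2 g s m / 2 * (x - m) ^ 2 +
      iteratedDerivWithin 3 g s m / 6 * (x - m) ^ 3 := by
  simp only [taylor_within_apply, Finset.sum_range_succ, Finset.sum_range_zero, Nat.factorial,
    iteratedDerivWithin_zero, smul_eq_mul]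
  push_cast
  ring

lemma abs_sub_interp₁_sub_bubble_le (hab : a < b) (hM : 1 ≤ M) (hl : l < M)
    (hg : ContDiffOn ℝ 4 g (Icc a b))
    (hK : ∀ x ∈ Icc a b, |iteratedDerivWithin 4 g (Icc a b) x| ≤ K)
    (hx : x ∈ Icc (node a b M (2 * l)) (node a b M (2 * l) + step a b M)) :
    |g x - interp₁ a b M g x -
        iteratedDerivWithin 3 g (Icc a b) (node a b M (2 * l) + step a b M / 2) / 6 *
          bubble (node a b M (2 * l)) (step a b M) x| ≤ 4 * K * step a b M ^ 4 := by
  have h := step_pos hab hM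
  have hsub := element_subset_Icc hab hM hl
  set p := node a b M (2 * l)
  set m := p + step a b M / 2 with hm
  have hmI : m ∈ Icc a b := hsub ⟨by linarith, by linarith⟩
  have hK0 : 0 ≤ K := (abs_nonneg _).trans (hK m hmI)
  set T := taylorWithinEval g 3 (Icc a b) m with hT
  have remainder : ∀ z ∈ Icc p (p + step a b M), |g z - T z| ≤ K * step a b M ^ 4 := by
    intro z hz
    refine (abs_sub_taylorWithinEval_le (n := 3) hab (by norm_num; exact hg) hK hmI
      (hsub hz)).trans ?_
    gcongr
    exact abs_le.mpr ⟨by linarith [hz.1], by linarith [hz.2]⟩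
  have cubic : T x - interp₁ a b M T x =
      iteratedDerivWithin 3 g (Icc a b) m / 6 * bubble p (step a b M) x := by
    rw [hT, funext (taylorWithinEval_three g (Icc a b) m)]
    exact sub_interp₁_cubic hab hM hl hx _ _ _ _ _
  calc |g x - interp₁ a b M g x -
        iteratedDerivWithin 3 g (Icc a b) m / 6 * bubble p (step a b M) x|
      = |(g x - T x) - (interp₁ a b M g x - interp₁ a b M T x)| := by
        rw [← cubic]
        ring_nf
    _ ≤ |g x - T x| + |interp₁ a b M g x - interp₁ a b M T x| := abs_sub _ _
    _ ≤ K * step a b M ^ 4 + 3 * (K * step a b M ^ 4) :=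
        add_le_add (remainder x hx) (abs_interp₁_sub_le hab hM hl hx remainder)
    _ = 4 * K * step a b M ^ 4 := by ring

end Interp₁

section WeightedError

variable {γ ξ a b K : ℝ} {M i k l : ℕ} {g : ℝ → ℝ}

/-- The weighted quadratic interpolation error of `g` over `[a, b]`, with singularity at `ξ`. -/
noncomputable def weightedError (γ ξ a b : ℝ) (M : ℕ) (g : ℝ → ℝ) : ℝ :=
  ∫ x in a..b, (g x - interp₁ a b M g x) * weight γ ξ x

lemma intervalIntegrable_basisFun_mul_weight (hγ : γ < 1) (hab : a < b) (hM : 1 ≤ M)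
    (hk : k ≤ 2 * M) (ξ : ℝ) :
    IntervalIntegrable (fun x ↦ basisFun a b M k x * weight γ ξ x) volume a b := by
  have hw := intervalIntegrable_weight hγ ξ a b
  rw [intervalIntegrable_iff_integrableOn_Ioc_of_le hab.le] at hw ⊢
  refine Integrable.bdd_mul (c := 3) hw (measurable_basisFun a b M k).aestronglyMeasurable ?_
  filter_upwards [ae_restrict_mem measurableSet_Ioc] with x hx
  exact abs_basisFun_le hab hM hk ⟨hx.1.le, hx.2⟩

lemma intervalIntegrable_sub_interp₁_mul_weight (hγ : γ < 1) (hab : a < b) (hM : 1 ≤ M) (ξ : ℝ)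
    (hg : ContinuousOn g (Icc a b)) :
    IntervalIntegrable (fun x ↦ (g x - interp₁ a b M g x) * weight γ ξ x) volume a b := by
  have hgw : IntervalIntegrable (fun x ↦ g x * weight γ ξ x) volume a b :=
    (intervalIntegrable_weight hγ ξ a b).continuousOn_mul (by rwa [uIcc_of_le hab.le])
  have hIw : IntervalIntegrable (∑ k ∈ Finset.range (2 * M + 1),
      fun x ↦ basisFun a b M k x * weight γ ξ x * g (node a b M k)) volume a b :=
    IntervalIntegrable.sum _ fun k hk ↦ (intervalIntegrable_basisFun_mul_weight hγ hab hM
      (Nat.le_of_lt_succ (Finset.mem_range.mp hk)) ξ).mul_const _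
  refine (hgw.sub hIw).congr fun x _ ↦ ?_
  simp only [interp₁, sub_mul, Finset.sum_mul, Finset.sum_apply, mul_right_comm]

lemma abs_integral_element_sub_le (hγ : γ < 1) (hab : a < b) (hM : 1 ≤ M) (hl : l < M)
    (hg : ContDiffOn ℝ 4 g (Icc a b))
    (hK : ∀ x ∈ Icc a b, |iteratedDerivWithin 4 g (Icc a b) x| ≤ K) :
    |(∫ x in node a b M (2 * l)..node a b M (2 * l) + step a b M,
        (g x - interp₁ a b M g x) * weight γ ξ x) -
      iteratedDerivWithin 3 g (Icc a b) (node a b M (2 * l) + step a b M / 2) / 6 *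
        bubbleMoment γ ξ (step a b M) (node a b M (2 * l))| ≤
    4 * K * step a b M ^ 4 *
      ∫ x in node a b M (2 * l)..node a b M (2 * l) + step a b M, weight γ ξ x := by
  have h := step_pos hab hM
  have hle : node a b M (2 * l) ≤ node a b M (2 * l) + step a b M := by linarith
  have hint : IntervalIntegrable (fun x ↦ (g x - interp₁ a b M g x) * weight γ ξ x) volume
      (node a b M (2 * l)) (node a b M (2 * l) + step a b M) :=
    (intervalIntegrable_sub_interp₁_mul_weight hγ hab hM ξ hg.continuousOn).mono_set
      (by simpa only [uIcc_of_le hab.le, uIcc_of_le hle] using element_subset_Icc hab hM hl)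
  rw [bubbleMoment, ← intervalIntegral.integral_const_mul, ← intervalIntegral.integral_sub hint
    ((intervalIntegrable_bubble_mul_weight hγ _ _ _ _ _).const_mul _)]
  simpa only [sub_mul, mul_assoc] using
    abs_integral_mul_weight_le hγ hle fun x ↦ abs_sub_interp₁_sub_bubble_le hab hM hl hg hK

lemma abs_iteratedDerivWithin_sub_mul_bubbleMoment_le (hγ0 : 0 ≤ γ) (hγ1 : γ < 1) (hab : a < b)
    (hM : 1 ≤ M) (hl : l < M) (hi : i ≤ 2 * M) (hg : ContDiffOn ℝ 4 g (Icc a b))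
    (hK : ∀ x ∈ Icc a b, |iteratedDerivWithin 4 g (Icc a b) x| ≤ K) :
    |(iteratedDerivWithin 3 g (Icc a b) (node a b M (2 * l) + step a b M / 2) -
        iteratedDerivWithin 3 g (Icc a b) (node a b M i)) / 6 *
      bubbleMoment γ (node a b M i) (step a b M) (node a b M (2 * l))| ≤
    K * step a b M ^ 4 * ∫ x in node a b M (2 * l)..node a b M (2 * l) + step a b M,
      weight γ (node a b M i) x := by
  have h := step_pos hab hM
  have hξ := node_mem_Icc hab hM hi
  have hlip := abs_iteratedDerivWithin_sub_le (n := 3) hab (by norm_num; exact hg) hK hξ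
    (element_subset_Icc hab hM hl ⟨by linarith, by linarith⟩ :
      node a b M (2 * l) + step a b M / 2 ∈ Icc a b)
  have hmoment := abs_sub_mul_abs_bubbleMoment_le hγ0 hγ1 h
    (node_left_or_inside_or_right hab hM i l)
  have hK0 : 0 ≤ K := (abs_nonneg _).trans (hK _ hξ)
  set p := node a b M (2 * l)
  set ξ := node a b M i
  have hW := integral_weight_nonneg (γ := γ) (ξ := ξ) (by linarith : p ≤ p + step a b M)
  rw [abs_mul, abs_div, abs_of_pos (by norm_num : (0 : ℝ) < 6)]
  calc _ ≤ K * |p + step a b M / 2 - ξ| / 6 * |bubbleMoment γ ξ (step a b M) p| := by gcongr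
    _ = K / 6 * (|p + step a b M / 2 - ξ| * |bubbleMoment γ ξ (step a b M) p|) := by ring
    _ ≤ K / 6 * (3 * step a b M ^ 4 * ∫ x in p..p + step a b M, weight γ ξ x) := by gcongr
    _ = 1 / 2 * (K * step a b M ^ 4 * ∫ x in p..p + step a b M, weight γ ξ x) := by ring
    _ ≤ K * step a b M ^ 4 * ∫ x in p..p + step a b M, weight γ ξ x :=
        mul_le_of_le_one_left (by positivity) (by norm_num)

-- The factor in front of the moment no longer depends on the element, so that summing over the
-- elements lets the moments cancel.
lemma abs_integral_element_sub_node_le (hγ0 : 0 ≤ γ) (hγ1 : γ < 1) (hab : a < b) (hM : 1 ≤ M)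
    (hl : l < M) (hi : i ≤ 2 * M) (hg : ContDiffOn ℝ 4 g (Icc a b))
    (hK : ∀ x ∈ Icc a b, |iteratedDerivWithin 4 g (Icc a b) x| ≤ K) :
    |(∫ x in node a b M (2 * l)..node a b M (2 * l) + step a b M,
        (g x - interp₁ a b M g x) * weight γ (node a b M i) x) -
      iteratedDerivWithin 3 g (Icc a b) (node a b M i) / 6 *
        bubbleMoment γ (node a b M i) (step a b M) (node a b M (2 * l))| ≤
    5 * K * step a b M ^ 4 * ∫ x in node a b M (2 * l)..node a b M (2 * l) + step a b M,
      weight γ (node a b M i) x := by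
  have midpoint := abs_integral_element_sub_le (ξ := node a b M i) hγ1 hab hM hl hg hK
  have shift := abs_iteratedDerivWithin_sub_mul_bubbleMoment_le hγ0 hγ1 hab hM hl hi hg hK
  refine le_of_eq_of_le ?_ ((abs_add_le _ _).trans ((add_le_add midpoint shift).trans_eq ?_))
  · ring_nf
  · ring

theorem abs_weightedError_le (hγ0 : 0 ≤ γ) (hγ1 : γ < 1) (hab : a < b) (hM : 1 ≤ M) (hi : 1 ≤ i)
    (hiM : i < 2 * M) (hg : ContDiffOn ℝ 4 g (Icc a b))
    (hK₃ : ∀ x ∈ Icc a b, |iteratedDerivWithin 3 g (Icc a b) x| ≤ K)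
    (hK₄ : ∀ x ∈ Icc a b, |iteratedDerivWithin 4 g (Icc a b) x| ≤ K) :
    |weightedError γ (node a b M i) a b M g| ≤
      (1 + 10 * (b - a) / (1 - γ)) * K * (step a b M ^ 4 * eta a b M i ^ (-γ)) := by
  have h := step_pos hab hM
  have hξ := node_mem_Icc hab hM hiM.le
  have hK0 : 0 ≤ K := (abs_nonneg _).trans (hK₄ _ hξ)
  have hmoments := abs_sum_bubbleMoment_node_le hγ0 hγ1 hab hM hi hiM
  have hW := integral_weight_node_le hγ0 hγ1 hab hM hi hiM
  set ξ := node a b M i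
  set c := iteratedDerivWithin 3 g (Icc a b) ξ / 6 with hc
  set S := ∑ l ∈ Finset.range M, bubbleMoment γ ξ (step a b M) (node a b M (2 * l))
  have hc_le : |c| ≤ K := by
    rw [hc, abs_div, abs_of_pos (by norm_num : (0 : ℝ) < 6)]
    linarith [hK₃ ξ hξ]
  have elements : |weightedError γ ξ a b M g - c * S| ≤
      5 * K * step a b M ^ 4 * ∫ x in a..b, weight γ ξ x := by
    rw [weightedError, ← sum_integral_elements hab hM
      (intervalIntegrable_sub_interp₁_mul_weight hγ1 hab hM ξ hg.continuousOn),
      ← sum_integral_elements hab hM (intervalIntegrable_weight hγ1 ξ a b), Finset.mul_sum,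
      Finset.mul_sum, ← Finset.sum_sub_distrib]
    exact (Finset.abs_sum_le_sum_abs _ _).trans (Finset.sum_le_sum fun l hl ↦
      abs_integral_element_sub_node_le hγ0 hγ1 hab hM (Finset.mem_range.mp hl) hiM.le hg hK₄)
  calc |weightedError γ ξ a b M g| = |c * S + (weightedError γ ξ a b M g - c * S)| := by
        rw [add_sub_cancel]
    _ ≤ |c| * |S| + |weightedError γ ξ a b M g - c * S| := by
        rw [← abs_mul]
        exact abs_add_le _ _
    _ ≤ K * (step a b M ^ 4 * eta a b M i ^ (-γ)) + 5 * K * step a b M ^ 4 *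
          (2 * (b - a) / (1 - γ) * eta a b M i ^ (-γ)) := by
        refine add_le_add (by gcongr) (elements.trans (by gcongr))
    _ = (1 + 10 * (b - a) / (1 - γ)) * K * (step a b M ^ 4 * eta a b M i ^ (-γ)) := by ring

end WeightedError

section Slices

variable {γ a b c d : ℝ} {s t : Set ℝ} {n k : ℕ} {f : ℝ × ℝ → ℝ}

lemma exists_iteratedDerivWithin_slice_eq (hs : UniqueDiffOn ℝ s) (ht : UniqueDiffOn ℝ t)
    (hf : ContDiffOn ℝ (n + k : ℕ) f (s ×ˢ t)) :
    ∃ F : ℝ × ℝ → ℝ, ContDiffOn ℝ n F (s ×ˢ t) ∧ ∀ y ∈ t, ∀ x ∈ s,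
      iteratedDerivWithin k (fun x ↦ f (x, y)) s x = F (x, y) := by
  induction k generalizing n with
  | zero => exact ⟨f, hf, fun y _ x _ ↦ by rw [iteratedDerivWithin_zero]⟩
  | succ k ih =>
    obtain ⟨F, hF, hFeq⟩ := ih (n := n + 1) (by rwa [Nat.add_right_comm])
    refine ⟨fun p ↦ fderivWithin ℝ F (s ×ˢ t) p (1, 0),
      (hF.fderivWithin (hs.prod ht) (by norm_cast)).clm_apply contDiffOn_const, fun y hy x hx ↦ ?_⟩
    have hderiv : HasDerivWithinAt (fun x ↦ F (x, y))
        (fderivWithin ℝ F (s ×ˢ t) (x, y) (1, 0)) s x :=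
      (hF.differentiableOn (by simp) (x, y) ⟨hx, hy⟩).hasFDerivWithinAt.comp_hasDerivWithinAt
        (f := fun x ↦ (x, y)) x
        ((hasDerivWithinAt_id x s).prodMk (hasDerivWithinAt_const x s y)) fun z hz ↦ ⟨hz, hy⟩
    rw [iteratedDerivWithin_succ, derivWithin_congr (hFeq y hy) (hFeq y hy x hx),
      hderiv.derivWithin (hs x hx)]

lemma exists_abs_iteratedDerivWithin_slice_le (hs : UniqueDiffOn ℝ s) (ht : UniqueDiffOn ℝ t)
    (hsc : IsCompact s) (htc : IsCompact t) (hf : ContDiffOn ℝ k f (s ×ˢ t)) :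
    ∃ K, ∀ y ∈ t, ∀ x ∈ s, |iteratedDerivWithin k (fun x ↦ f (x, y)) s x| ≤ K := by
  obtain ⟨F, hF, hFeq⟩ :=
    exists_iteratedDerivWithin_slice_eq (n := 0) (k := k) hs ht (by rwa [zero_add])
  obtain ⟨K, hK⟩ := (hsc.prod htc).exists_bound_of_continuousOn hF.continuousOn
  exact ⟨K, fun y hy x hx ↦ by rw [hFeq y hy x hx]; exact hK (x, y) ⟨hx, hy⟩⟩

lemma exists_abs_weightedError_slice_le (hγ0 : 0 ≤ γ) (hγ1 : γ < 1) (hab : a < b) (hcd : c < d)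
    (hf : ContDiffOn ℝ 4 f (Icc a b ×ˢ Icc c d)) :
    ∃ C, 0 ≤ C ∧ ∀ y ∈ Icc c d, ∀ M i : ℕ, 1 ≤ M → 1 ≤ i → i < 2 * M →
      |weightedError γ (node a b M i) a b M (fun x ↦ f (x, y))| ≤
        C * (step a b M ^ 4 * eta a b M i ^ (-γ)) := by
  have hs := uniqueDiffOn_Icc hab
  have ht := uniqueDiffOn_Icc hcd
  obtain ⟨K₃, hK₃⟩ := exists_abs_iteratedDerivWithin_slice_le (k := 3) hs ht isCompact_Icc
    isCompact_Icc (hf.of_le (by norm_num))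
  obtain ⟨K₄, hK₄⟩ := exists_abs_iteratedDerivWithin_slice_le (k := 4) hs ht isCompact_Icc
    isCompact_Icc hf
  have hK0 : 0 ≤ max K₃ K₄ := (abs_nonneg _).trans
    ((hK₃ c ⟨le_rfl, hcd.le⟩ a ⟨le_rfl, hab.le⟩).trans (le_max_left _ _))
  have hconst : 0 ≤ 1 + 10 * (b - a) / (1 - γ) :=
    add_nonneg zero_le_one (div_nonneg (by linarith) (by linarith))
  refine ⟨(1 + 10 * (b - a) / (1 - γ)) * max K₃ K₄, mul_nonneg hconst hK0,
    fun y hy M i hM hi hiM ↦ ?_⟩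
  have slice : ContDiffOn ℝ 4 (fun x ↦ f (x, y)) (Icc a b) :=
    hf.comp (f := fun x ↦ (x, y)) (contDiff_id.prodMk contDiff_const).contDiffOn
      fun x hx ↦ ⟨hx, hy⟩
  exact abs_weightedError_le hγ0 hγ1 hab hM hi hiM slice
    (fun x hx ↦ (hK₃ y hy x hx).trans (le_max_left _ _))
    (fun x hx ↦ (hK₄ y hy x hx).trans (le_max_right _ _))

end Slices

section ErrIntegrand

variable {γ ξ ζ a b c d Bx By : ℝ} {M Mx My i j : ℕ} {f g : ℝ → ℝ} {u : ℝ → ℝ → ℝ}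

/-- The integral of a basis function over `[a, b]` against the weight with singularity at `ξ`. -/
noncomputable def basisMoment (γ ξ a b : ℝ) (M k : ℕ) : ℝ :=
  ∫ x in a..b, basisFun a b M k x * weight γ ξ x

lemma sum_abs_basisMoment_le (hγ : γ < 1) (hab : a < b) (hM : 1 ≤ M) (ξ : ℝ) :
    ∑ k ∈ Finset.range (2 * M + 1), |basisMoment γ ξ a b M k| ≤
      3 * ∫ x in a..b, weight γ ξ x := by
  have hint : ∀ k ∈ Finset.range (2 * M + 1),
      IntervalIntegrable (fun x ↦ |basisFun a b M k x * weight γ ξ x|) volume a b := fun k hk ↦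
    (intervalIntegrable_basisFun_mul_weight hγ hab hM
      (Nat.le_of_lt_succ (Finset.mem_range.mp hk)) ξ).abs
  calc ∑ k ∈ Finset.range (2 * M + 1), |basisMoment γ ξ a b M k|
      ≤ ∑ k ∈ Finset.range (2 * M + 1), ∫ x in a..b, |basisFun a b M k x * weight γ ξ x| :=
        Finset.sum_le_sum fun k _ ↦ intervalIntegral.abs_integral_le_integral_abs hab.le
    _ = ∫ x in a..b, ∑ k ∈ Finset.range (2 * M + 1), |basisFun a b M k x * weight γ ξ x| :=
        (intervalIntegral.integral_finsetSum hint).symm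
    _ ≤ ∫ x in a..b, 3 * weight γ ξ x := by
        refine intervalIntegral.integral_mono_on hab.le
          (by simpa only [Finset.sum_fn] using IntervalIntegrable.sum _ hint)
          ((intervalIntegrable_weight hγ ξ a b).const_mul 3) fun x hx ↦ ?_
        simp only [abs_mul, abs_of_nonneg (weight_nonneg γ ξ x), ← Finset.sum_mul]
        exact mul_le_mul_of_nonneg_right (sum_abs_basisFun_le hab hM hx) (weight_nonneg γ ξ x)
    _ = 3 * ∫ x in a..b, weight γ ξ x := intervalIntegral.integral_const_mul _ _

lemma errIntegrand_eq (γ a b c d : ℝ) (u : ℝ → ℝ → ℝ) (Mx My i j : ℕ) (x y : ℝ) :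
    errIntegrand γ a b c d u Mx My i j x y = (u x y - interp a b c d Mx My u x y) *
      (weight γ (node a b Mx i) x * weight γ (node c d My j) y) := by
  rw [errIntegrand, weight, weight, Real.rpow_neg (abs_nonneg _), Real.rpow_neg (abs_nonneg _),
    div_eq_mul_inv, mul_inv]

lemma interp_eq_sum_interp₁ (a b c d : ℝ) (Mx My : ℕ) (u : ℝ → ℝ → ℝ) (x y : ℝ) :
    interp a b c d Mx My u x y = ∑ k ∈ Finset.range (2 * Mx + 1),
      basisFun a b Mx k x * interp₁ c d My (u (node a b Mx k)) y := by
  simp only [interp, interp₁, Finset.mul_sum, mul_assoc]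

-- With `I` and `J` the interpolation operators in `x` and in `y`, this is
-- `u - I J u = (u - I u) + I (u - J u)`.
lemma errIntegrand_eq_add (γ a b c d : ℝ) (u : ℝ → ℝ → ℝ) (Mx My i j : ℕ) (x y : ℝ) :
    errIntegrand γ a b c d u Mx My i j x y =
      weight γ (node c d My j) y *
        ((u x y - interp₁ a b Mx (fun x ↦ u x y) x) * weight γ (node a b Mx i) x) +
      ∑ k ∈ Finset.range (2 * Mx + 1),
        (u (node a b Mx k) y - interp₁ c d My (u (node a b Mx k)) y) *
          weight γ (node c d My j) y * (basisFun a b Mx k x * weight γ (node a b Mx i) x) := by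
  have second : (interp₁ a b Mx (fun x ↦ u x y) x - interp a b c d Mx My u x y) *
        (weight γ (node a b Mx i) x * weight γ (node c d My j) y) =
      ∑ k ∈ Finset.range (2 * Mx + 1),
        (u (node a b Mx k) y - interp₁ c d My (u (node a b Mx k)) y) *
          weight γ (node c d My j) y * (basisFun a b Mx k x * weight γ (node a b Mx i) x) := by
    rw [interp_eq_sum_interp₁, interp₁, ← Finset.sum_sub_distrib, Finset.sum_mul]
    exact Finset.sum_congr rfl fun k _ ↦ by ring
  rw [← second, errIntegrand_eq]
  ring

lemma integrableOn_mul_prod (hab : a ≤ b) (hcd : c ≤ d) (hf : IntervalIntegrable f volume a b)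
    (hg : IntervalIntegrable g volume c d) :
    IntegrableOn (fun p : ℝ × ℝ ↦ f p.1 * g p.2) (Icc a b ×ˢ Icc c d) volume := by
  rw [intervalIntegrable_iff_integrableOn_Icc_of_le hab] at hf
  rw [intervalIntegrable_iff_integrableOn_Icc_of_le hcd] at hg
  rw [IntegrableOn, Measure.volume_eq_prod, ← Measure.prod_restrict]
  exact Integrable.mul_prod hf hg

lemma integrableOn_errIntegrand (hγ : γ < 1) (hab : a < b) (hcd : c < d)
    (hu : ContinuousOn (fun p : ℝ × ℝ ↦ u p.1 p.2) (Icc a b ×ˢ Icc c d))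
    (hMx : 1 ≤ Mx) (hMy : 1 ≤ My) (i j : ℕ) :
    IntegrableOn (fun p : ℝ × ℝ ↦ errIntegrand γ a b c d u Mx My i j p.1 p.2)
      (Icc a b ×ˢ Icc c d) volume := by
  have function_part : IntegrableOn (fun p : ℝ × ℝ ↦ u p.1 p.2 *
      (weight γ (node a b Mx i) p.1 * weight γ (node c d My j) p.2))
      (Icc a b ×ˢ Icc c d) volume :=
    (integrableOn_mul_prod hab.le hcd.le (intervalIntegrable_weight hγ _ _ _)
      (intervalIntegrable_weight hγ _ _ _)).continuousOn_mul hu (isCompact_Icc.prod isCompact_Icc)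
  have interpolant_part : IntegrableOn (fun p : ℝ × ℝ ↦ ∑ l ∈ Finset.range (2 * Mx + 1),
      ∑ r ∈ Finset.range (2 * My + 1), u (node a b Mx l) (node c d My r) *
        ((basisFun a b Mx l p.1 * weight γ (node a b Mx i) p.1) *
          (basisFun c d My r p.2 * weight γ (node c d My j) p.2)))
      (Icc a b ×ˢ Icc c d) volume :=
    integrable_finsetSum _ fun l hl ↦ integrable_finsetSum _ fun r hr ↦
      (integrableOn_mul_prod hab.le hcd.le
        (intervalIntegrable_basisFun_mul_weight hγ hab hMx
          (Nat.le_of_lt_succ (Finset.mem_range.mp hl)) _)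
        (intervalIntegrable_basisFun_mul_weight hγ hcd hMy
          (Nat.le_of_lt_succ (Finset.mem_range.mp hr)) _)).const_mul _
  refine (function_part.sub interpolant_part).congr (.of_forall fun p ↦ ?_)
  simp only [Pi.sub_apply, errIntegrand_eq, sub_mul, interp, Finset.sum_mul]
  congr 1
  exact Finset.sum_congr rfl fun l _ ↦ Finset.sum_congr rfl fun r _ ↦ by ring

lemma intervalIntegrable_integral_left {F : ℝ → ℝ → ℝ} (hab : a ≤ b) (hcd : c ≤ d)
    (hF : IntegrableOn (fun p : ℝ × ℝ ↦ F p.1 p.2) (Icc a b ×ˢ Icc c d) volume) :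
    IntervalIntegrable (fun y ↦ ∫ x in a..b, F x y) volume c d := by
  rw [IntegrableOn, Measure.volume_eq_prod, ← Measure.prod_restrict] at hF
  rw [intervalIntegrable_iff_integrableOn_Icc_of_le hcd]
  simp only [intervalIntegral.integral_of_le hab, ← integral_Icc_eq_integral_Ioc]
  exact hF.integral_prod_right

lemma integral_errIntegrand_left {y : ℝ} (hγ : γ < 1) (hab : a < b) (hMx : 1 ≤ Mx)
    (hu : ContinuousOn (fun x ↦ u x y) (Icc a b)) :
    ∫ x in a..b, errIntegrand γ a b c d u Mx My i j x y =
      weight γ (node c d My j) y *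
        weightedError γ (node a b Mx i) a b Mx (fun x ↦ u x y) +
      ∑ k ∈ Finset.range (2 * Mx + 1),
        (u (node a b Mx k) y - interp₁ c d My (u (node a b Mx k)) y) *
          weight γ (node c d My j) y * basisMoment γ (node a b Mx i) a b Mx k := by
  have first := (intervalIntegrable_sub_interp₁_mul_weight hγ hab hMx (node a b Mx i) hu).const_mul
    (weight γ (node c d My j) y)
  have second : ∀ k ∈ Finset.range (2 * Mx + 1), IntervalIntegrable (fun x ↦
      (u (node a b Mx k) y - interp₁ c d My (u (node a b Mx k)) y) *
        weight γ (node c d My j) y * (basisFun a b Mx k x * weight γ (node a b Mx i) x))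
      volume a b := fun k hk ↦ (intervalIntegrable_basisFun_mul_weight hγ hab hMx
    (Nat.le_of_lt_succ (Finset.mem_range.mp hk)) _).const_mul _
  simp only [errIntegrand_eq_add]
  rw [intervalIntegral.integral_add first
      (by simpa only [Finset.sum_fn] using IntervalIntegrable.sum _ second),
    intervalIntegral.integral_finsetSum second]
  simp only [intervalIntegral.integral_const_mul, weightedError, basisMoment]

lemma abs_sum_weightedError_mul_basisMoment_le (hγ : γ < 1) (hab : a < b) (hMx : 1 ≤ Mx)
    (hBy : ∀ x ∈ Icc a b, |weightedError γ ζ c d My (u x)| ≤ By) (ξ : ℝ) :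
    |∑ k ∈ Finset.range (2 * Mx + 1),
        weightedError γ ζ c d My (u (node a b Mx k)) * basisMoment γ ξ a b Mx k| ≤
      By * (3 * ∫ x in a..b, weight γ ξ x) := by
  have hBy0 : 0 ≤ By := (abs_nonneg _).trans (hBy a ⟨le_rfl, hab.le⟩)
  calc _ ≤ ∑ k ∈ Finset.range (2 * Mx + 1),
        |weightedError γ ζ c d My (u (node a b Mx k)) * basisMoment γ ξ a b Mx k| :=
        Finset.abs_sum_le_sum_abs _ _
    _ ≤ ∑ k ∈ Finset.range (2 * Mx + 1), By * |basisMoment γ ξ a b Mx k| := by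
        refine Finset.sum_le_sum fun k hk ↦ ?_
        rw [abs_mul]
        gcongr
        exact hBy _ (node_mem_Icc hab hMx (Nat.le_of_lt_succ (Finset.mem_range.mp hk)))
    _ ≤ By * (3 * ∫ x in a..b, weight γ ξ x) := by
        rw [← Finset.mul_sum]
        gcongr
        exact sum_abs_basisMoment_le hγ hab hMx ξ

theorem abs_integral_errIntegrand_le (hγ : γ < 1) (hab : a < b) (hcd : c < d)
    (hu : ContinuousOn (fun p : ℝ × ℝ ↦ u p.1 p.2) (Icc a b ×ˢ Icc c d))
    (hMx : 1 ≤ Mx) (hMy : 1 ≤ My)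
    (hBx : ∀ y ∈ Icc c d, |weightedError γ (node a b Mx i) a b Mx (fun x ↦ u x y)| ≤ Bx)
    (hBy : ∀ x ∈ Icc a b, |weightedError γ (node c d My j) c d My (u x)| ≤ By) :
    |∫ y in c..d, ∫ x in a..b, errIntegrand γ a b c d u Mx My i j x y| ≤
      Bx * (∫ y in c..d, weight γ (node c d My j) y) +
        By * (3 * ∫ x in a..b, weight γ (node a b Mx i) x) := by
  set ξ := node a b Mx i
  set ζ := node c d My j
  have hux : ∀ y ∈ Icc c d, ContinuousOn (fun x ↦ u x y) (Icc a b) := fun y hy ↦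
    hu.comp (f := fun x ↦ (x, y)) (by fun_prop) fun x hx ↦ ⟨hx, hy⟩
  have huy : ∀ x ∈ Icc a b, ContinuousOn (u x) (Icc c d) := fun x hx ↦
    hu.comp (f := fun y ↦ (x, y)) (by fun_prop) fun y hy ↦ ⟨hx, hy⟩
  set P : ℝ → ℝ := fun y ↦ ∫ x in a..b, errIntegrand γ a b c d u Mx My i j x y with hP
  set E : ℕ → ℝ → ℝ := fun k y ↦ (u (node a b Mx k) y - interp₁ c d My (u (node a b Mx k)) y) *
    weight γ ζ y * basisMoment γ ξ a b Mx k with hE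
  have hPint : IntervalIntegrable P volume c d := intervalIntegrable_integral_left hab.le hcd.le
    (integrableOn_errIntegrand hγ hab hcd hu hMx hMy i j)
  have hEint : ∀ k ∈ Finset.range (2 * Mx + 1), IntervalIntegrable (E k) volume c d := fun k hk ↦
    (intervalIntegrable_sub_interp₁_mul_weight hγ hcd hMy ζ (huy _ (node_mem_Icc hab hMx
      (Nat.le_of_lt_succ (Finset.mem_range.mp hk))))).mul_const _
  have first : |∫ y in c..d, (P y - ∑ k ∈ Finset.range (2 * Mx + 1), E k y)| ≤
      Bx * ∫ y in c..d, weight γ ζ y := by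
    rw [intervalIntegral.integral_congr (g := fun y ↦
      weightedError γ ξ a b Mx (fun x ↦ u x y) * weight γ ζ y) fun y hy ↦ ?_]
    · exact abs_integral_mul_weight_le hγ hcd.le hBx
    · rw [uIcc_of_le hcd.le] at hy
      simp only [hP, hE, integral_errIntegrand_left hγ hab hMx (hux y hy)]
      ring
  have second : |∫ y in c..d, ∑ k ∈ Finset.range (2 * Mx + 1), E k y| ≤
      By * (3 * ∫ x in a..b, weight γ ξ x) := by
    rw [intervalIntegral.integral_finsetSum hEint]
    simp only [hE, intervalIntegral.integral_mul_const]
    exact abs_sum_weightedError_mul_basisMoment_le hγ hab hMx hBy ξ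
  have split := intervalIntegral.integral_sub hPint
    (by simpa only [Finset.sum_fn] using IntervalIntegrable.sum _ hEint)
  rw [← sub_add_cancel (∫ y in c..d, P y) (∫ y in c..d, ∑ k ∈ Finset.range (2 * Mx + 1), E k y),
    ← split]
  exact (abs_add_le _ _).trans (add_le_add first second)

end ErrIntegrand

end PQC

open PQC MeasureTheory Set in
theorem lemma3p9_general (γ : ℝ) (hγ0 : 0 ≤ γ) (hγ1 : γ < 1) (a b c d : ℝ) (hab : a < b)
    (hcd : c < d) (u : ℝ → ℝ → ℝ)
    (hu : ContDiffOn ℝ 4 (fun p : ℝ × ℝ ↦ u p.1 p.2) (Icc a b ×ˢ Icc c d)) :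
    ∃ C : ℝ, 0 ≤ C ∧ ∀ Mx My : ℕ, 1 ≤ Mx → 1 ≤ My →
      ∀ i j : ℕ, 1 ≤ i → i < 2 * Mx → 1 ≤ j → j < 2 * My →
        IntegrableOn (fun p : ℝ × ℝ ↦ errIntegrand γ a b c d u Mx My i j p.1 p.2)
            (Icc a b ×ˢ Icc c d) volume ∧
        |∫ y in c..d, ∫ x in a..b, errIntegrand γ a b c d u Mx My i j x y| ≤
          C * (step a b Mx ^ 4 * eta a b Mx i ^ (-γ) +
            step c d My ^ 4 * eta c d My j ^ (-γ)) := by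
  obtain ⟨Cx, hCx0, hCx⟩ := exists_abs_weightedError_slice_le hγ0 hγ1 hab hcd hu
  obtain ⟨Cy, hCy0, hCy⟩ := exists_abs_weightedError_slice_le hγ0 hγ1 hcd hab
    (hu.comp (f := Prod.swap) (contDiff_snd.prodMk contDiff_fst).contDiffOn fun p hp ↦ hp.symm)
  set Wx := 2 * (b - a) ^ (1 - γ) / (1 - γ)
  set Wy := 2 * (d - c) ^ (1 - γ) / (1 - γ)
  have hWy0 : 0 ≤ Wy := (integral_weight_nonneg hcd.le).trans
    (integral_weight_le hγ1 (left_mem_Icc.mpr hcd.le))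
  refine ⟨max (Cx * Wy) (Cy * (3 * Wx)), le_max_of_le_left (mul_nonneg hCx0 hWy0),
    fun Mx My hMx hMy i j hi hiM hj hjM ↦
      ⟨integrableOn_errIntegrand hγ1 hab hcd hu.continuousOn hMx hMy i j, ?_⟩⟩
  have hWx := integral_weight_le hγ1 (node_mem_Icc hab hMx hiM.le)
  have hWy := integral_weight_le hγ1 (node_mem_Icc hcd hMy hjM.le)
  have hηx := eta_pos hab hMx hi hiM
  have hηy := eta_pos hcd hMy hj hjM
  set X := step a b Mx ^ 4 * eta a b Mx i ^ (-γ)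
  set Y := step c d My ^ 4 * eta c d My j ^ (-γ)
  calc _ ≤ Cx * X * (∫ y in c..d, weight γ (node c d My j) y) +
          Cy * Y * (3 * ∫ x in a..b, weight γ (node a b Mx i) x) :=
        abs_integral_errIntegrand_le hγ1 hab hcd hu.continuousOn hMx hMy
          (fun y hy ↦ hCx y hy Mx i hMx hi hiM) (fun x hx ↦ hCy x hx My j hMy hj hjM)
    _ ≤ Cx * X * Wy + Cy * Y * (3 * Wx) := by gcongr
    _ = Cx * Wy * X + Cy * (3 * Wx) * Y := by ring
    _ ≤ max (Cx * Wy) (Cy * (3 * Wx)) * (X + Y) := by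
        rw [mul_add]
        gcongr
        exacts [le_max_left _ _, le_max_right _ _]

theorem lemma3p9 (γ : ℝ) (hγ0 : 0 < γ) (hγ1 : γ < 1) (a b c d : ℝ) (hab : a < b) (hcd : c < d)
    (u : ℝ → ℝ → ℝ)
    (hu : ContDiffOn ℝ 6 (fun p : ℝ × ℝ => u p.1 p.2) (Set.Icc a b ×ˢ Set.Icc c d)) :
    ∃ C : ℝ, ∀ Mx My : ℕ, 1 ≤ Mx → 1 ≤ My →
      ∀ i j : ℕ, 1 ≤ i → i < 2 * Mx → 1 ≤ j → j < 2 * My →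
        MeasureTheory.IntegrableOn
            (fun p : ℝ × ℝ => PQC.errIntegrand γ a b c d u Mx My i j p.1 p.2)
            (Set.Icc a b ×ˢ Set.Icc c d) MeasureTheory.volume ∧
        |∫ y in c..d, ∫ x in a..b, PQC.errIntegrand γ a b c d u Mx My i j x y| ≤
          C * (PQC.step a b Mx ^ 4 * PQC.eta a b Mx i ^ (-γ) +
               PQC.step c d My ^ 4 * PQC.eta c d My j ^ (-γ)) +
          C * (PQC.step a b Mx ^ (5 - γ) + PQC.step c d My ^ (5 - γ)) := by
  obtain ⟨C, hC, bound⟩ := lemma3p9_general γ hγ0.le hγ1 a b c d hab hcd u (hu.of_le (by norm_num))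
  exact ⟨C, fun Mx My hMx hMy i j hi hiM hj hjM ↦
    (bound Mx My hMx hMy i j hi hiM hj hjM).imp_right fun h ↦
      h.trans <| le_add_of_nonneg_right <| mul_nonneg hC <| add_nonneg
        (Real.rpow_nonneg (PQC.step_pos hab hMx).le _)
        (Real.rpow_nonneg (PQC.step_pos hcd hMy).le _)⟩
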